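/- All hypergraphs are finite, with a non-empty vertex set and without repeated edges; a $3$-graph is a hypergraph all of whose edges have exactly $3$ vertices. A complete $3$-uniform Berge-hypergraph of order $n$ is a $3$-graph for which there are $n$ distinct vertices $v_1,\dots,v_n$ (the core) such that its edges are $\binom n2$ pairwise distinct sets $e_{ij}$, $1\le i<j\le n$, with $\{v_i,v_j\}\subseteq e_{ij}$, and whose vertices are the core vertices together with the vertices lying in the edges (which may lie outside the core). Let $\mathcal F_n^{(3)}$ be the family of all complete $3$-uniform Berge-hypergraphs of order $n$. A $3$-graph is $\mathcal F_n^{(3)}$-free if it contains no member of $\mathcal F_n^{(3)}$ as a (not necessarily induced) subgraph, and $ex(N,\mathcal F_n^{(3)})$ is the maximum number of edges of an $\mathcal F_n^{(3)}$-free $3$-graph on $N$ vertices; an $\mathcal F_n^{(3)}$-free $3$-graph on $N$ vertices with $ex(N,\mathcal F_n^{(3)})$ edges is called extremal. Let $T_3(N,n-1)$ be the complete $3$-uniform $(n-1)$-partite hypergraph on $N$ vertices whose part sizes differ by at most $1$: its edges are all the $3$-sets of vertices with at most one vertex in each part. Let $t_3(N,n-1)$ be its number of edges. **Theorem.** Let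 $N,n$ be integers with $N\ge n\ge 13$. Then $$ex(N,\mathcal F_n^{(3)})=t_3(N,n-1).$$ Furthermore, $T_3(N,n-1)$ is extremal, and it is the unique extremal hypergraph: every extremal $3$-graph on $N$ vertices is isomorphic to $T_3(N,n-1)$. -/

import Mathlib

namespace BergeTuran

universe u v

/-- `H` is an `r`-graph: an `r`-uniform hypergraph on a finite non-empty vertex set. -/
structure IsRGraph {α : Type u} (r : ℕ) (H : Hypergraph α) : Prop where
  finite : H.vertexSet.Finite
  nonempty : H.vertexSet.Nonempty
  uniform : ∀ e ∈ H.edgeSet, e.ncard = r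

/-- The number of vertices. -/
noncomputable def order {α : Type u} (H : Hypergraph α) : ℕ := H.vertexSet.ncard

/-- The number of edges. -/
noncomputable def numEdges {α : Type u} (H : Hypergraph α) : ℕ := H.edgeSet.ncard

/-- `H` contains (a copy of) `F` as a (not necessarily induced) subgraph. -/
def Contains {α : Type u} {β : Type v} (H : Hypergraph α) (F : Hypergraph β) : Prop :=
  ∃ f : β → α, Set.InjOn f F.vertexSet ∧ Set.MapsTo f F.vertexSet H.vertexSet ∧
    ∀ e ∈ F.edgeSet, f '' e ∈ H.edgeSet

/-- Isomorphism of hypergraphs. -/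
def IsIsomorphic {α : Type u} {β : Type v} (H : Hypergraph α) (H' : Hypergraph β) : Prop :=
  ∃ f : α → β, Set.BijOn f H.vertexSet H'.vertexSet ∧
    ∀ e ⊆ H.vertexSet, e ∈ H.edgeSet ↔ f '' e ∈ H'.edgeSet

/-- `H` is `𝓕`-free. Forbidden families consist of finite hypergraphs, which up to isomorphism
have their vertices in `ℕ`. -/
def IsFree {α : Type u} (𝓕 : Set (Hypergraph ℕ)) (H : Hypergraph α) : Prop :=
  ∀ F ∈ 𝓕, ¬ Contains H F

/-- `H` is an `𝓕`-free `r`-graph on `N` vertices. -/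
def IsFreeRGraph {α : Type u} (r N : ℕ) (𝓕 : Set (Hypergraph ℕ)) (H : Hypergraph α) : Prop :=
  IsRGraph r H ∧ order H = N ∧ IsFree 𝓕 H

/-- The Turán number `ex(N, 𝓕)` of a family `𝓕` of `r`-graphs: the maximum number of edges of an
`𝓕`-free `r`-graph on `N` vertices. -/
noncomputable def turanNumber (r N : ℕ) (𝓕 : Set (Hypergraph ℕ)) : ℕ :=
  sSup {m : ℕ | ∃ H : Hypergraph ℕ, IsFreeRGraph r N 𝓕 H ∧ numEdges H = m}

/-- `H` is an extremal hypergraph on `N` vertices for the family `𝓕` of `r`-graphs. -/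
def IsExtremal {α : Type u} (r N : ℕ) (𝓕 : Set (Hypergraph ℕ)) (H : Hypergraph α) : Prop :=
  IsFreeRGraph r N 𝓕 H ∧ numEdges H = turanNumber r N 𝓕

/-- `F` is a complete `r`-uniform Berge-hypergraph of order `n`: there are distinct core vertices
`c 0, …, c (n - 1)`, and the edges of `F` are pairwise distinct sets `e (i, j)`, `i < j`, with
`c i, c j ∈ e (i, j)`. The vertices of `F` are the core vertices together with the vertices that
lie in the edges. -/
def IsCompleteBerge {α : Type u} (r n : ℕ) (F : Hypergraph α) : Prop :=
  IsRGraph r F ∧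
    ∃ (c : Fin n → α) (e : {p : Fin n × Fin n // p.1 < p.2} → Set α),
      Function.Injective c ∧ Function.Injective e ∧
      (∀ p, c p.1.1 ∈ e p ∧ c p.1.2 ∈ e p) ∧
      F.edgeSet = Set.range e ∧
      F.vertexSet = Set.range c ∪ ⋃ p, e p

/-- The family `𝓕_n^{(r)}` of complete `r`-uniform Berge-hypergraphs of order `n`. -/
def bergeFamily (r n : ℕ) : Set (Hypergraph ℕ) := {F | IsCompleteBerge r n F}

/-- The complete `r`-uniform multipartite hypergraph on the vertex set `V` whose parts are the
fibres of `part` on `V`: the edges are the `r`-subsets of `V` with at most one vertex in each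
part. -/
def completePartite {α : Type u} {ι : Type v} (r : ℕ) (V : Set α) (part : α → ι) :
    Hypergraph α where
  vertexSet := V
  edgeSet := {e | e ⊆ V ∧ e.ncard = r ∧ Set.InjOn part e}
  subset_vertexSet_of_mem_edgeSet' := fun _ he => he.1

/-- `T_r(N, k)`: the complete `r`-uniform `k`-partite hypergraph on `N` vertices whose part sizes
differ by at most one. The vertices are `0, …, N - 1` and the parts are the residue classes
modulo `k`. -/
def turanHypergraph (r N k : ℕ) : Hypergraph ℕ :=
  completePartite r (Set.Iio N) (fun x => x % k)

/-- The parts of `turanHypergraph r N k` differ in size by at most one. -/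
theorem turanHypergraph_balanced (r N k i j : ℕ) (hi : i < k) (hj : j < k) :
    {x ∈ (turanHypergraph r N k).vertexSet | x % k = i}.ncard ≤
      {x ∈ (turanHypergraph r N k).vertexSet | x % k = j}.ncard + 1 := by
  have key : ∀ a, a < k → {x ∈ (turanHypergraph r N k).vertexSet | x % k = a}.ncard =
      N / k + if a < N % k then 1 else 0 := by
    intro a ha
    have h := Nat.count_modEq_card N (by omega : 0 < k) a
    rw [Nat.mod_eq_of_lt ha, Nat.count_eq_card_filter_range] at h
    rw [← h, ← Set.ncard_coe_finset]
    congr 1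
    ext x
    simp [turanHypergraph, completePartite, Nat.ModEq, Nat.mod_eq_of_lt ha]
  rw [key i hi, key j hj]
  split_ifs <;> omega

/-- `t_r(N, k)`: the number of edges of `T_r(N, k)`. -/
noncomputable def turanEdges (r N k : ℕ) : ℕ := numEdges (turanHypergraph r N k)

end BergeTuran

namespace BergeTuran

set_option linter.unusedSectionVars false

/-! ### Zykov symmetrization for red-blue coloured graphs. -/

section ColoredGraphs

open Finset

variable {V : Type*} [Fintype V] [DecidableEq V] {G R B : SimpleGraph V} {u v a b : V} {k : ℕ}

/-! The problem is reduced to one about coloured graphs. Among the subsystems of the triple system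
`A` of edges, take `A'` maximizing the number of triples minus the number of pairs they cover. By
Hall's theorem, each pair covered by `A'` gets its own triple of `A'` containing it, and each
remaining triple gets its own pair, not covered by `A'`. Colour the former pairs blue and the latter
red (`exists_coloring_of_tripleSystem`). Then `A` has at most as many triples as there are red edges
and blue triangles ("cells"), and every coloured pair has a private triple containing it. A coloured
`K_n` would thus be the core of a complete Berge-hypergraph, so the coloured graph is `K_n`-free.

It remains to maximize the number of cells over coloured `K_{k+1}`-free graphs, `k = n - 1`. Cloning
vertices shows that a maximum is complete multipartite (`IsMaxColoring.not_adj_trans`), and it has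
exactly `k` parts. A red edge lies in at least `k - 2` triangles, a triangle has only three edges,
and `k - 2 > 3`, so painting everything blue would gain cells if any edge were red
(`IsMaxColoring.red_eq_bot`). Moving a vertex between parts then forces balance. All maxima being
blue Turán graphs, uniqueness comes with the bound. -/

open Classical in
/-- The red edges and the blue triangles of a graph whose edges are coloured red and blue. -/
noncomputable def cells (R B : SimpleGraph V) : Finset (Finset V) :=
  univ.filter fun s => R.IsNClique 2 s ∨ B.IsNClique 3 s

theorem mem_cells {s : Finset V} : s ∈ cells R B ↔ R.IsNClique 2 s ∨ B.IsNClique 3 s := by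
  simp [cells]

theorem isNClique_two_pair : G.IsNClique 2 {a, b} ↔ G.Adj a b := by
  constructor
  · intro h
    have hab : a ≠ b := by
      rintro rfl
      simpa using h.card_eq
    exact h.isClique (by simp) (by simp) hab
  · intro h
    rw [SimpleGraph.isNClique_iff, card_pair h.ne]
    refine ⟨?_, rfl⟩
    intro x hx y hy hxy
    simp only [coe_insert, coe_singleton, Set.mem_insert_iff, Set.mem_singleton_iff] at hx hy
    rcases hx with rfl | rfl <;> rcases hy with rfl | rfl
    · exact absurd rfl hxy
    · exact h
    · exact h.symm
    · exact absurd rfl hxy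

theorem exists_adj_eq_pair {s : Finset V} (h : G.IsNClique 2 s) :
    ∃ a b, G.Adj a b ∧ s = {a, b} := by
  obtain ⟨a, b, -, rfl⟩ := card_eq_two.1 h.card_eq
  exact ⟨a, b, isNClique_two_pair.1 h, rfl⟩

theorem adj_of_mem_cells {s : Finset V} (hs : s ∈ cells R B) (ha : a ∈ s) (hb : b ∈ s)
    (hab : a ≠ b) : (R ⊔ B).Adj a b := by
  rcases mem_cells.1 hs with h | h
  · exact Or.inl (h.isClique ha hb hab)
  · exact Or.inr (h.isClique ha hb hab)

/-- Pulling back makes each fibre independent, so only sets on which `f` is injective can be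
cliques. For `f = Function.update id v u` the pullback is Zykov's operation: `v` becomes a clone of
`u`, not adjacent to it. -/
theorem isNClique_comap_iff {f : V → V} {s : Finset V} :
    (G.comap f).IsNClique k s ↔ Set.InjOn f s ∧ G.IsNClique k (s.image f) := by
  constructor
  · intro h
    have hf : Set.InjOn f s := by
      intro a ha b hb hab
      by_contra hne
      exact G.ne_of_adj (h.isClique ha hb hne) hab
    refine ⟨hf, ?_, by rw [card_image_of_injOn hf, h.card_eq]⟩
    intro x hx y hy hxy
    simp only [coe_image, Set.mem_image, mem_coe] at hx hy
    obtain ⟨a, ha, rfl⟩ := hx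
    obtain ⟨b, hb, rfl⟩ := hy
    exact h.isClique ha hb (fun e => hxy (by rw [e]))
  · rintro ⟨hf, h⟩
    refine ⟨?_, by rw [← h.card_eq, card_image_of_injOn hf]⟩
    intro a ha b hb hab
    exact h.isClique (by simpa using ⟨a, ha, rfl⟩) (by simpa using ⟨b, hb, rfl⟩)
      (fun e => hab (hf ha hb e))

theorem mem_cells_comap {f : V → V} {s : Finset V} :
    s ∈ cells (R.comap f) (B.comap f) ↔ Set.InjOn f s ∧ s.image f ∈ cells R B := by
  simp only [mem_cells, isNClique_comap_iff]
  tauto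

theorem image_update_of_notMem {s : Finset V} (hv : v ∉ s) :
    s.image (Function.update id v u) = s := by
  conv_rhs => rw [← image_id (s := s)]
  refine image_congr fun x hx => ?_
  rw [Function.update_of_ne]
  rintro rfl
  exact hv hx

theorem injOn_update_of_notMem {s : Finset V} (hv : v ∉ s) :
    Set.InjOn (Function.update id v u) s := by
  intro x hx y hy hxy
  rwa [Function.update_of_ne, Function.update_of_ne] at hxy
  · rintro rfl; exact hv hy
  · rintro rfl; exact hv hx

theorem mem_cells_comap_update_of_notMem {s : Finset V} (hv : v ∉ s) :
    s ∈ cells (R.comap (Function.update id v u)) (B.comap (Function.update id v u)) ↔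
      s ∈ cells R B := by
  rw [mem_cells_comap, image_update_of_notMem hv]
  simp [injOn_update_of_notMem hv]

/-- The number of cells after `v` has been made a clone of `u`. -/
theorem card_cells_comap_update (huv : u ≠ v) :
    #(cells (R.comap (Function.update id v u)) (B.comap (Function.update id v u)))
        + #{s ∈ cells R B | v ∈ s} + #{s ∈ cells R B | u ∈ s ∧ v ∈ s} =
      #(cells R B) + #{s ∈ cells R B | u ∈ s} := by
  set C := cells R B with hC
  set C' := cells (R.comap (Function.update id v u)) (B.comap (Function.update id v u)) with hC'
  have h1 : #C' = #{s ∈ C' | v ∈ s} + #{s ∈ C' | v ∉ s} :=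
    (card_filter_add_card_filter_not _).symm
  have h2 : #C = #{s ∈ C | v ∈ s} + #{s ∈ C | v ∉ s} :=
    (card_filter_add_card_filter_not _).symm
  have h3 : {s ∈ C' | v ∉ s} = {s ∈ C | v ∉ s} := by
    ext s
    simp only [mem_filter, and_congr_left_iff]
    exact fun hv => mem_cells_comap_update_of_notMem hv
  have h4 : #{s ∈ C | u ∈ s} = #{s ∈ C | u ∈ s ∧ v ∈ s} + #{s ∈ C | u ∈ s ∧ v ∉ s} := by
    rw [← card_filter_add_card_filter_not (s := {s ∈ C | u ∈ s}) (fun s => v ∈ s), filter_filter,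
      filter_filter]
  -- The cells at the clone `v` correspond to the old cells at `u` that avoid `v`, by exchanging `v`
  -- and `u`.
  have h5 : #{s ∈ C' | v ∈ s} = #{s ∈ C | u ∈ s ∧ v ∉ s} := by
    have himg : ∀ s ∈ C', v ∈ s → u ∉ s ∧
        s.image (Function.update id v u) = insert u (s.erase v) := by
      intro s hs hv
      have hinj := (mem_cells_comap.1 hs).1
      have hu : u ∉ s := by
        intro hu
        exact huv (hinj hu hv (by simp [Function.update_of_ne huv]))
      refine ⟨hu, ?_⟩
      conv_lhs => rw [← insert_erase hv]
      rw [image_insert, image_update_of_notMem (notMem_erase v s), Function.update_self]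
    refine card_bij (fun s _ => insert u (s.erase v)) ?_ ?_ ?_
    · intro s hs
      rw [mem_filter] at hs ⊢
      obtain ⟨hu, he⟩ := himg s hs.1 hs.2
      refine ⟨?_, by simp, by simp [huv.symm]⟩
      rw [← he]
      exact (mem_cells_comap.1 hs.1).2
    · intro s hs t ht hst
      rw [mem_filter] at hs ht
      obtain ⟨hu, -⟩ := himg s hs.1 hs.2
      obtain ⟨hu', -⟩ := himg t ht.1 ht.2
      have := congrArg (fun x => insert v (x.erase u)) hst
      rwa [erase_insert (by simp [hu]), erase_insert (by simp [hu']), insert_erase hs.2,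
        insert_erase ht.2] at this
    · intro t ht
      rw [mem_filter] at ht
      obtain ⟨htC, hu, hv⟩ := ht
      have he : (insert v (t.erase u)).image (Function.update id v u) = t := by
        rw [image_insert, image_update_of_notMem (by simp [hv]), Function.update_self,
          insert_erase hu]
      refine ⟨insert v (t.erase u), ?_, ?_⟩
      · rw [mem_filter]
        refine ⟨mem_cells_comap.2 ⟨?_, by rwa [he]⟩, by simp⟩
        rw [← card_image_iff, he, card_insert_of_notMem (by simp [hv]), card_erase_add_one hu]
      · rw [erase_insert (by simp [hv]), insert_erase hu]
  rw [h3] at h1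
  omega

/-- The number of cells at a vertex `y` not adjacent to `u`, after `v` has been made a clone
of `u`. -/
theorem card_cells_comap_update_filter {y : V} (hy : y ≠ v)
    (hyu : ¬ (R ⊔ B).Adj u y) :
    #{s ∈ cells (R.comap (Function.update id v u)) (B.comap (Function.update id v u)) | y ∈ s}
        + #{s ∈ cells R B | v ∈ s ∧ y ∈ s} = #{s ∈ cells R B | y ∈ s} := by
  rw [← card_filter_add_card_filter_not (s := {s ∈ cells R B | y ∈ s}) (fun s => v ∈ s),
    filter_filter, filter_filter, add_comm]
  congr 2
  · ext s
    simp [and_comm]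
  · ext s
    simp only [mem_filter]
    constructor
    · rintro ⟨hs, hys⟩
      have hv : v ∉ s := by
        intro hv
        have hadj := adj_of_mem_cells hs hv hys hy.symm
        simp only [SimpleGraph.sup_adj, SimpleGraph.comap_adj, Function.update_self,
          Function.update_of_ne hy, id] at hadj
        exact hyu hadj
      exact ⟨(mem_cells_comap_update_of_notMem hv).1 hs, hys, hv⟩
    · rintro ⟨hs, hys, hv⟩
      exact ⟨(mem_cells_comap_update_of_notMem hv).2 hs, hys⟩

/-- A red-blue edge colouring of a `K_{k+1}`-free graph. -/
structure IsColoring (k : ℕ) (R B : SimpleGraph V) : Prop where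
  disjoint : ∀ x y, R.Adj x y → ¬ B.Adj x y
  cliqueFree : (R ⊔ B).CliqueFree (k + 1)

/-- A red-blue edge coloured `K_{k+1}`-free graph with the maximum number of cells. -/
structure IsMaxColoring (k : ℕ) (R B : SimpleGraph V) : Prop extends IsColoring k R B where
  max : ∀ R' B' : SimpleGraph V, IsColoring k R' B' → #(cells R' B') ≤ #(cells R B)

theorem IsColoring.comap (h : IsColoring k R B) (f : V → V) :
    IsColoring k (R.comap f) (B.comap f) where
  disjoint _ _ := h.disjoint _ _
  cliqueFree s hs := by
    have : (R.comap f) ⊔ (B.comap f) = (R ⊔ B).comap f := by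
      ext; simp
    rw [this, isNClique_comap_iff] at hs
    exact h.cliqueFree _ hs.2

theorem exists_isMaxColoring (hk : 1 ≤ k) : ∃ R B : SimpleGraph V, IsMaxColoring k R B := by
  classical
  have hne : (univ.filter fun p : SimpleGraph V × SimpleGraph V => IsColoring k p.1 p.2).Nonempty :=
    ⟨(⊥, ⊥), by
      rw [mem_filter]
      refine ⟨mem_univ _, by simp, ?_⟩
      rw [sup_bot_eq]
      exact SimpleGraph.cliqueFree_bot (by omega)⟩
  obtain ⟨p, hp, hmax⟩ := exists_max_image _ (fun p => #(cells p.1 p.2)) hne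
  exact ⟨p.1, p.2, (mem_filter.1 hp).2, fun R' B' h => hmax (R', B') (by simpa using h)⟩

theorem IsMaxColoring.of_card_le (h : IsMaxColoring k R B) {R' B' : SimpleGraph V}
    (h' : IsColoring k R' B') (hc : #(cells R B) ≤ #(cells R' B')) : IsMaxColoring k R' B' :=
  ⟨h', fun R₁ B₁ h₁ => (h.max R₁ B₁ h₁).trans hc⟩

theorem cells_filter_eq_empty_of_not_adj (huv : u ≠ v) (h : ¬ (R ⊔ B).Adj u v) :
    {s ∈ cells R B | u ∈ s ∧ v ∈ s} = ∅ := by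
  rw [filter_eq_empty_iff]
  rintro s hs ⟨hu, hv⟩
  exact h (adj_of_mem_cells hs hu hv huv)

/-- Otherwise replacing the vertex in fewer cells by a clone of the other would gain cells. -/
theorem IsMaxColoring.card_filter_eq_of_not_adj (hm : IsMaxColoring k R B)
    (h : ¬ (R ⊔ B).Adj u v) : #{s ∈ cells R B | u ∈ s} = #{s ∈ cells R B | v ∈ s} := by
  wlog hle : #{s ∈ cells R B | u ∈ s} ≤ #{s ∈ cells R B | v ∈ s} generalizing u v
  · exact (this (fun h' => h h'.symm) (le_of_not_ge hle)).symm
  by_cases huv : u = v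
  · rw [huv]
  have h1 := card_cells_comap_update (R := R) (B := B) (Ne.symm huv)
  rw [cells_filter_eq_empty_of_not_adj (Ne.symm huv) (fun h' => h h'.symm), card_empty] at h1
  have h2 := hm.max _ _ (hm.toIsColoring.comap (Function.update id u v))
  omega

/-- In a maximum colouring, every edge lies in a cell. -/
theorem IsMaxColoring.exists_mem_cells (hm : IsMaxColoring k R B) (h : (R ⊔ B).Adj u v) :
    ∃ s ∈ cells R B, u ∈ s ∧ v ∈ s := by
  by_cases hR : R.Adj u v
  · exact ⟨{u, v}, mem_cells.2 (Or.inl (isNClique_two_pair.2 hR)), by simp, by simp⟩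
  by_contra! hno
  have hB : B.Adj u v := h.resolve_left hR
  -- Recolouring this blue edge red creates the cell `{u, v}` and, since no blue triangle uses the
  -- edge, destroys none.
  set E := SimpleGraph.edge u v with hE
  have hadj : ∀ x y, E.Adj x y ↔ (u = x ∧ v = y ∨ u = y ∧ v = x) := by
    intro x y
    rw [hE, SimpleGraph.edge_adj]
    have := hB.ne
    grind
  have hcol : IsColoring k (R ⊔ E) (B \ E) := by
    constructor
    · rintro x y (hx | hx) ⟨hy, hy'⟩
      · exact hm.disjoint x y hx hy
      · exact hy' hx
    · refine hm.cliqueFree.anti ?_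
      rintro x y ((hx | hx) | hx)
      · exact Or.inl hx
      · right
        rcases (hadj x y).1 hx with ⟨rfl, rfl⟩ | ⟨rfl, rfl⟩
        · exact hB
        · exact hB.symm
      · exact Or.inr hx.1
  have hlt : #(cells R B) < #(cells (R ⊔ E) (B \ E)) := by
    apply card_lt_card
    rw [ssubset_iff]
    refine ⟨{u, v}, fun hmem => hno _ hmem (by simp) (by simp), ?_⟩
    intro s hs
    rw [mem_insert] at hs
    rw [mem_cells]
    rcases hs with rfl | hs
    · left
      rw [isNClique_two_pair]
      exact Or.inr ((hadj u v).2 (by simp))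
    · rcases mem_cells.1 hs with h2 | h3
      · exact Or.inl (h2.mono le_sup_left)
      · right
        refine ⟨?_, h3.card_eq⟩
        intro x hx y hy hxy
        refine ⟨h3.isClique hx hy hxy, fun hexy => ?_⟩
        rcases (hadj x y).1 hexy with ⟨rfl, rfl⟩ | ⟨rfl, rfl⟩
        · exact hno s hs hx hy
        · exact hno s hs hy hx
  exact absurd (hm.max _ _ hcol) (by omega)

/-- In a maximum colouring, non-adjacency is transitive. -/
theorem IsMaxColoring.not_adj_trans (hm : IsMaxColoring k R B) {x : V}
    (huv : ¬ (R ⊔ B).Adj u v) (hvx : ¬ (R ⊔ B).Adj v x) : ¬ (R ⊔ B).Adj u x := by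
  intro hux
  have hne : v ≠ u := by
    rintro rfl
    exact hvx hux
  have hvu : ¬ (R ⊔ B).Adj v u := fun h => huv h.symm
  have h1 := card_cells_comap_update (R := R) (B := B) hne
  rw [cells_filter_eq_empty_of_not_adj hne hvu, card_empty,
    hm.card_filter_eq_of_not_adj huv] at h1
  -- Making `u` a clone of `v` keeps the number of cells, so the result is again maximum. But `x`
  -- loses the cells it shared with `u`, of which there is at least one, while `v` loses none; so
  -- the non-adjacent `v` and `x` no longer lie in equally many cells.
  have hm' := hm.of_card_le (hm.toIsColoring.comap (Function.update id u v)) (by omega)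
  have h2 := card_cells_comap_update_filter (R := R) (B := B) (u := v) (v := u) (y := v) hne (by simp)
  have h3 := card_cells_comap_update_filter (R := R) (B := B) (u := v) (v := u) (y := x) hux.ne' hvx
  have hvx' : ¬ (R.comap (Function.update id u v) ⊔ B.comap (Function.update id u v)).Adj v x := by
    simpa [Function.update_of_ne hne, Function.update_of_ne hux.ne'] using hvx
  have h4 := hm'.card_filter_eq_of_not_adj hvx'
  rw [cells_filter_eq_empty_of_not_adj hne.symm huv, card_empty] at h2
  have h5 := hm.card_filter_eq_of_not_adj hvx
  obtain ⟨s, hs, hus, hxs⟩ := hm.exists_mem_cells hux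
  have h6 : 0 < #{s ∈ cells R B | u ∈ s ∧ x ∈ s} :=
    card_pos.2 ⟨s, by simp [hs, hus, hxs]⟩
  omega

end ColoredGraphs

/-! ### Maximum colourings are blue Turán graphs. -/

section MaximumColorings

open Finset

variable {V : Type*} [Fintype V] [DecidableEq V] {G R B : SimpleGraph V} {u v a b : V} {k : ℕ}
  {P : Finpartition (univ : Finset V)}

/-- A graph underlying a maximum colouring is complete multipartite. -/
theorem IsMaxColoring.exists_finpartition (hm : IsMaxColoring k R B) :
    ∃ P : Finpartition (univ : Finset V), ∀ a b, (R ⊔ B).Adj a b ↔ P.part a ≠ P.part b := by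
  classical
  let S : Setoid V := ⟨fun a b => ¬ (R ⊔ B).Adj a b,
    ⟨fun a => by simp, fun h h' => h h'.symm, fun h h' => hm.not_adj_trans h h'⟩⟩
  refine ⟨Finpartition.ofSetoid S, fun a b => ?_⟩
  have h : b ∈ (Finpartition.ofSetoid S).part a ↔ S a b := Finpartition.mem_part_ofSetoid_iff_rel
  rw [Finpartition.mem_part_iff_part_eq_part _ (mem_univ b) (mem_univ a)] at h
  have h' : S a b ↔ ¬ (R ⊔ B).Adj a b := Iff.rfl
  rw [h'] at h
  rw [ne_comm, ne_eq, h, not_not]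

theorem card_parts_le_of_cliqueFree (hP : ∀ a b, G.Adj a b ↔ P.part a ≠ P.part b)
    (hG : G.CliqueFree (k + 1)) : #P.parts ≤ k := by
  by_contra! l
  obtain ⟨z, -, hz⟩ := P.exists_subset_part_bijOn
  have ncf : ¬ G.CliqueFree #z := by
    refine SimpleGraph.IsNClique.not_cliqueFree (s := z) ⟨fun v hv w hw hn ↦ ?_, rfl⟩
    rw [hP]
    exact fun h => hn (hz.injOn hv hw h)
  rw [Finset.card_eq_of_equiv hz.equiv] at ncf
  exact ncf (hG.mono l)

theorem IsMaxColoring.card_parts (hm : IsMaxColoring k R B)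
    (hP : ∀ a b, (R ⊔ B).Adj a b ↔ P.part a ≠ P.part b) (hk : k ≤ Fintype.card V) :
    #P.parts = k := by
  refine le_antisymm (card_parts_le_of_cliqueFree hP hm.cliqueFree) ?_
  by_contra! hlt
  obtain ⟨x, -, y, -, hne, he⟩ :=
    exists_ne_map_eq_of_card_lt_of_maps_to (hlt.trans_le hk) fun a _ ↦ P.part_mem.2 (mem_univ a)
  have hxy : ¬ (R ⊔ B).Adj x y := fun h => (hP x y).1 h he
  set E := SimpleGraph.edge x y with hE
  have hadj : ∀ c d, E.Adj c d ↔ (x = c ∧ y = d ∨ x = d ∧ y = c) := by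
    intro c d
    rw [hE, SimpleGraph.edge_adj]
    grind
  -- With fewer than `k` parts there is not even a `K_k`, so one edge can be added inside a part
  -- without creating a `K_{k+1}`. Added in red, it is a new cell.
  have hfree : (R ⊔ B).CliqueFree k := by
    intro z hz
    obtain ⟨c, hc, d, hd, hcd, hp⟩ := exists_ne_map_eq_of_card_lt_of_maps_to
      (hz.card_eq.symm ▸ hlt) fun a (_ : a ∈ z) ↦ P.part_mem.2 (mem_univ a)
    exact (hP c d).1 (hz.isClique hc hd hcd) hp
  have hcol : IsColoring k (R ⊔ E) B := by
    constructor
    · rintro c d (h | h) hB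
      · exact hm.disjoint c d h hB
      · rcases (hadj c d).1 h with ⟨rfl, rfl⟩ | ⟨rfl, rfl⟩
        · exact hxy (Or.inr hB)
        · exact hxy (Or.inr hB.symm)
    · have h : R ⊔ E ⊔ B = (R ⊔ B) ⊔ E := sup_right_comm _ _ _
      rw [h]
      exact hfree.sup_edge x y
  have hlt' : #(cells R B) < #(cells (R ⊔ E) B) := by
    apply card_lt_card
    rw [ssubset_iff]
    refine ⟨{x, y}, fun hmem => hxy (adj_of_mem_cells hmem (by simp) (by simp) hne), ?_⟩
    intro s hs
    rw [mem_insert] at hs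
    rw [mem_cells]
    rcases hs with rfl | hs
    · left
      rw [isNClique_two_pair]
      exact Or.inr ((hadj x y).2 (by simp))
    · rcases mem_cells.1 hs with h2 | h3
      · exact Or.inl (h2.mono le_sup_left)
      · exact Or.inr h3
  exact absurd (hm.max _ _ hcol) (by omega)

/-- Each part other than those of `a` and `b` contributes at least one vertex. For adjacent `a` and
`b` this bounds from below the number of triangles on the edge. -/
theorem card_parts_le_card_other (P : Finpartition (univ : Finset V)) (a b : V) :
    #P.parts ≤ #{c | P.part c ≠ P.part a ∧ P.part c ≠ P.part b} + 2 := by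
  have hsub : P.parts ⊆ ({c | P.part c ≠ P.part a ∧ P.part c ≠ P.part b} : Finset V).image P.part
      ∪ {P.part a, P.part b} := by
    intro p hp
    obtain ⟨c, hc⟩ := P.nonempty_of_mem_parts hp
    have hpc := P.part_eq_of_mem hp hc
    simp only [mem_union, mem_image, mem_filter, mem_univ, true_and, mem_insert, mem_singleton]
    by_cases h1 : p = P.part a
    · exact Or.inr (Or.inl h1)
    by_cases h2 : p = P.part b
    · exact Or.inr (Or.inr h2)
    exact Or.inl ⟨c, ⟨by rwa [hpc], by rwa [hpc]⟩, hpc⟩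
  calc #P.parts ≤ _ := card_le_card hsub
    _ ≤ _ := card_union_le _ _
    _ ≤ _ := Nat.add_le_add card_image_le card_le_two

/-- In a maximum colouring, all edges are blue. -/
theorem IsMaxColoring.red_eq_bot (hm : IsMaxColoring k R B) (hk : 6 ≤ k)
    (hV : k ≤ Fintype.card V) : R = ⊥ := by
  classical
  obtain ⟨P, hP⟩ := hm.exists_finpartition
  have hparts := hm.card_parts hP hV
  set E : Finset (Finset V) := univ.filter fun s => R.IsNClique 2 s with hE
  set T : Finset (Finset V) := univ.filter fun s => B.IsNClique 3 s with hT
  -- `D` collects the triangles with a red edge: they are not cells yet, and become cells once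
  -- everything is blue.
  set D : Finset (Finset V) :=
    univ.filter fun s => (R ⊔ B).IsNClique 3 s ∧ ∃ e ∈ E, e ⊆ s with hD
  have hcells : #(cells R B) = #E + #T := by
    rw [← card_union_of_disjoint]
    · congr 1
      ext s
      simp [mem_cells, hE, hT]
    · rw [disjoint_left]
      intro s hs ht
      simp only [hE, hT, mem_filter, mem_univ, true_and] at hs ht
      have := hs.card_eq.symm.trans ht.card_eq
      omega
  have hcol : IsColoring k (⊥ : SimpleGraph V) (R ⊔ B) :=
    ⟨fun x y h => absurd h (by simp), by simpa using hm.cliqueFree⟩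
  have hle : #T + #D ≤ #(cells ⊥ (R ⊔ B)) := by
    rw [← card_union_of_disjoint]
    · apply card_le_card
      intro s hs
      rw [mem_cells]
      simp only [hD, hT, mem_union, mem_filter, mem_univ, true_and] at hs
      rcases hs with hs | hs
      · exact Or.inr (hs.mono le_sup_right)
      · exact Or.inr hs.1
    · rw [disjoint_left]
      intro s hs ht
      simp only [hD, hT, hE, mem_filter, mem_univ, true_and] at hs ht
      obtain ⟨-, e, he, hes⟩ := ht
      obtain ⟨x, y, hxy, rfl⟩ := exists_adj_eq_pair he
      exact hm.disjoint x y hxy (hs.isClique (hes (by simp)) (hes (by simp)) hxy.ne)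
  -- Double counting: a red edge lies in at least `k - 2 ≥ 4` triangles, and a triangle contains at
  -- most 3 red edges. Maximality gives `#D ≤ #E`, hence `#E = 0`.
  have hdc : #E * 4 ≤ #D * 3 := by
    apply card_mul_le_card_mul (fun e s : Finset V => e ⊆ s)
    · intro e he
      obtain ⟨x, y, hxy, rfl⟩ := exists_adj_eq_pair (mem_filter.1 he).2
      have hL := card_parts_le_card_other P x y
      have hinj : #({c | P.part c ≠ P.part x ∧ P.part c ≠ P.part y} : Finset V) ≤
          #(D.bipartiteAbove (fun e s : Finset V => e ⊆ s) {x, y}) := by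
        have hne : ∀ c, P.part c ≠ P.part x ∧ P.part c ≠ P.part y → c ∉ ({x, y} : Finset V) := by
          intro c hc hmem
          simp only [mem_insert, mem_singleton] at hmem
          rcases hmem with rfl | rfl
          · exact hc.1 rfl
          · exact hc.2 rfl
        apply card_le_card_of_injOn (fun c => insert c {x, y})
        · intro c hc
          simp only [coe_filter, Set.mem_ofPred_eq, mem_univ, true_and] at hc
          rw [mem_coe, mem_bipartiteAbove]
          refine ⟨?_, subset_insert _ _⟩
          rw [hD, mem_filter]
          refine ⟨mem_univ _, ?_, {x, y}, he, subset_insert _ _⟩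
          rw [SimpleGraph.is3Clique_triple_iff]
          exact ⟨(hP c x).2 hc.1, (hP c y).2 hc.2, Or.inl hxy⟩
        · intro c hc d hd hcd
          simp only [coe_filter, Set.mem_ofPred_eq, mem_univ, true_and] at hc hd
          have : c ∈ insert d ({x, y} : Finset V) := by
            rw [← show insert c ({x, y} : Finset V) = insert d {x, y} from hcd]
            exact mem_insert_self _ _
          rw [mem_insert] at this
          exact this.resolve_right (hne c hc)
      omega
    · intro s hs
      have hs3 : #s = 3 := (mem_filter.1 hs).2.1.card_eq
      calc _ ≤ #(s.powersetCard 2) := by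
            apply card_le_card
            intro e he
            rw [mem_bipartiteBelow] at he
            exact mem_powersetCard.2 ⟨he.2, (mem_filter.1 he.1).2.card_eq⟩
        _ = 3 := by rw [card_powersetCard, hs3]; rfl
  have hmax := hm.max _ _ hcol
  have hE0 : #E = 0 := by omega
  rw [card_eq_zero, hE, filter_eq_empty_iff] at hE0
  ext x y
  simp only [SimpleGraph.bot_adj, iff_false]
  exact fun hxy => hE0 (mem_univ {x, y}) (isNClique_two_pair.2 hxy)

/-- The number of triangles at a vertex of a complete multipartite graph, in terms of a second
part. -/
theorem card_triangles_filter (hP : ∀ a b, G.Adj a b ↔ P.part a ≠ P.part b)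
    (huv : P.part u ≠ P.part v) (E : Finset (Finset V))
    (hE : ∀ s, s ∈ E ↔ G.IsNClique 2 s ∧ ∀ c ∈ s, P.part c ≠ P.part u ∧ P.part c ≠ P.part v) :
    #{s ∈ cells ⊥ G | u ∈ s} =
      #E + #(P.part v) * #{c | P.part c ≠ P.part u ∧ P.part c ≠ P.part v} := by
  set L : Finset V := {c | P.part c ≠ P.part u ∧ P.part c ≠ P.part v} with hL
  have hLm : ∀ c, c ∈ L ↔ P.part c ≠ P.part u ∧ P.part c ≠ P.part v := by simp [hL]
  have hv : ∀ w, w ∈ P.part v ↔ P.part w = P.part v := fun w =>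
    Finpartition.mem_part_iff_part_eq_part _ (mem_univ w) (mem_univ v)
  -- The side opposite `u` in a triangle either avoids the parts of both `u` and `v` (counted by
  -- `E`) or joins the part of `v` to `L`. As `E` and `L` are symmetric in `u` and `v`, the counts
  -- at the two vertices differ only through the sizes of their parts.
  have hprod : #((P.part v ×ˢ L).image fun p => ({p.1, p.2} : Finset V)) =
      #(P.part v) * #L := by
    rw [card_image_of_injOn, card_product]
    rintro ⟨w, l⟩ h ⟨w', l'⟩ h' he
    simp only [coe_product, Set.mem_prod, mem_coe, hv, hLm] at h h'
    dsimp only at he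
    have h1 : w ∈ ({w', l'} : Finset V) := he ▸ mem_insert_self _ _
    have h2 : l ∈ ({w', l'} : Finset V) := he ▸ by simp
    simp only [mem_insert, mem_singleton] at h1 h2
    grind
  have hdisj : Disjoint E ((P.part v ×ˢ L).image fun p => ({p.1, p.2} : Finset V)) := by
    rw [disjoint_left]
    intro s hs ht
    rw [mem_image] at ht
    obtain ⟨⟨w, l⟩, hwl, rfl⟩ := ht
    rw [mem_product, hv] at hwl
    exact (((hE _).1 hs).2 w (by simp)).2 hwl.1
  rw [← hprod, ← card_union_of_disjoint hdisj]
  have hpart : ∀ s ∈ E ∪ (P.part v ×ˢ L).image (fun p => ({p.1, p.2} : Finset V)),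
      G.IsNClique 2 s ∧ ∀ c ∈ s, P.part u ≠ P.part c := by
    intro s hs
    rw [mem_union, hE, mem_image] at hs
    rcases hs with hs | ⟨⟨w, l⟩, hwl, rfl⟩
    · exact ⟨hs.1, fun c hc => (hs.2 c hc).1.symm⟩
    · rw [mem_product, hv, hLm] at hwl
      refine ⟨isNClique_two_pair.2 ((hP w l).2 ?_), ?_⟩
      · rw [hwl.1]
        exact hwl.2.2.symm
      · intro c hc
        simp only [mem_insert, mem_singleton] at hc
        rcases hc with rfl | rfl
        · rw [hwl.1]
          exact huv
        · exact hwl.2.1.symm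
  symm
  refine card_bij (fun s _ => insert u s) ?_ ?_ ?_
  · intro s hs
    obtain ⟨h1, h2⟩ := hpart s hs
    rw [mem_filter, mem_cells]
    exact ⟨Or.inr (h1.insert fun c hc => (hP u c).2 (h2 c hc)), mem_insert_self _ _⟩
  · intro s hs t ht hst
    have h1 : u ∉ s := fun h => (hpart s hs).2 u h rfl
    have h2 : u ∉ t := fun h => (hpart t ht).2 u h rfl
    rw [← erase_insert h1, ← erase_insert h2, hst]
  · intro s hs
    rw [mem_filter, mem_cells] at hs
    obtain ⟨hs, hus⟩ := hs
    have h3 : G.IsNClique 3 s := by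
      refine hs.resolve_left fun h => ?_
      obtain ⟨x, y, hxy, -⟩ := exists_adj_eq_pair h
      exact hxy
    refine ⟨s.erase u, ?_, insert_erase hus⟩
    have h2 : G.IsNClique 2 (s.erase u) := h3.erase_of_mem hus
    obtain ⟨x, y, hxy, he⟩ := exists_adj_eq_pair h2
    have hx : x ∈ s.erase u := by simp [he]
    have hy : y ∈ s.erase u := by simp [he]
    have hxu := (hP _ _).1 (h3.isClique (mem_of_mem_erase hx) hus (ne_of_mem_erase hx))
    have hyu := (hP _ _).1 (h3.isClique (mem_of_mem_erase hy) hus (ne_of_mem_erase hy))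
    have hxy' := (hP _ _).1 hxy
    rw [he, mem_union, hE, mem_image]
    by_cases hxv : P.part x = P.part v
    · right
      refine ⟨(x, y), mem_product.2 ⟨(hv x).2 hxv, (hLm y).2 ⟨hyu, ?_⟩⟩, rfl⟩
      rw [← hxv]
      exact hxy'.symm
    by_cases hyv : P.part y = P.part v
    · right
      exact ⟨(y, x), mem_product.2 ⟨(hv y).2 hyv, (hLm x).2 ⟨hxu, hxv⟩⟩, pair_comm _ _⟩
    left
    refine ⟨he ▸ h2, fun c hc => ?_⟩
    simp only [mem_insert, mem_singleton] at hc
    rcases hc with rfl | rfl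
    · exact ⟨hxu, hxv⟩
    · exact ⟨hyu, hyv⟩

theorem IsMaxColoring.isEquipartition (hm : IsMaxColoring k ⊥ B) (hk : 3 ≤ k)
    (hV : k ≤ Fintype.card V) (hP : ∀ a b, B.Adj a b ↔ P.part a ≠ P.part b) :
    P.IsEquipartition := by
  classical
  have hparts := hm.card_parts (P := P) (by simpa using hP) hV
  by_contra hn
  rw [Finpartition.not_isEquipartition] at hn
  obtain ⟨large, hl, small, hs, ineq⟩ := hn
  obtain ⟨v, hv⟩ := P.nonempty_of_mem_parts hl
  obtain ⟨u, hu⟩ := P.nonempty_of_mem_parts hs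
  obtain rfl := P.part_eq_of_mem hl hv
  obtain rfl := P.part_eq_of_mem hs hu
  have huv : P.part u ≠ P.part v := by
    intro h
    rw [h] at ineq
    omega
  have hne : u ≠ v := by
    rintro rfl
    exact huv rfl
  have hL := card_parts_le_card_other P u v
  set L : Finset V := {c | P.part c ≠ P.part u ∧ P.part c ≠ P.part v} with hLdef
  set E : Finset (Finset V) := univ.filter fun s =>
    B.IsNClique 2 s ∧ ∀ c ∈ s, P.part c ≠ P.part u ∧ P.part c ≠ P.part v with hE
  have hwu := card_triangles_filter hP huv E (by simp [hE])
  have hwv := card_triangles_filter hP huv.symm E (by simp [hE, and_comm])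
  have hLcomm : ({c | P.part c ≠ P.part v ∧ P.part c ≠ P.part u} : Finset V) = L := by
    rw [hLdef]
    ext c
    simp [and_comm]
  rw [hLcomm] at hwv
  rw [← hLdef] at hwu
  have hwuv : #{s ∈ cells ⊥ B | u ∈ s ∧ v ∈ s} ≤ #L := by
    refine (card_le_card (t := L.image fun c => {u, v, c}) ?_).trans card_image_le
    intro s hs
    simp only [mem_filter, mem_cells] at hs
    obtain ⟨hs, hus, hvs⟩ := hs
    have h3 : B.IsNClique 3 s := by
      refine hs.resolve_left fun h => ?_
      obtain ⟨x, y, hxy, -⟩ := exists_adj_eq_pair h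
      exact hxy
    have h1 := (h3.erase_of_mem hus).erase_of_mem (mem_erase.2 ⟨hne.symm, hvs⟩)
    obtain ⟨c, hc⟩ := card_eq_one.1 h1.card_eq
    have hcs : c ∈ (s.erase u).erase v := by simp [hc]
    have hcs' : c ≠ v ∧ c ≠ u ∧ c ∈ s := by simpa using hcs
    rw [mem_image]
    refine ⟨c, ?_, ?_⟩
    · rw [hLdef, mem_filter]
      exact ⟨mem_univ _, (hP _ _).1 (h3.isClique hcs'.2.2 hus hcs'.2.1),
        (hP _ _).1 (h3.isClique hcs'.2.2 hvs hcs'.1)⟩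
    · rw [← hc, insert_erase (mem_erase.2 ⟨hne.symm, hvs⟩), insert_erase hus]
  have hcount := card_cells_comap_update (R := ⊥) (B := B) hne
  have hmax := hm.max _ _ (hm.toIsColoring.comap (Function.update id v u))
  -- Cloning `u` at `v` moves `v` to the smaller part. The sizes differ by at least 2, so this gains
  -- at least `2 * #L` minus the at most `#L` cells containing both vertices.
  have hmul : (#(P.part u) + 2) * #L ≤ #(P.part v) * #L := Nat.mul_le_mul_right _ (by omega)
  have hpos : 0 < #L := by omega
  rw [add_mul] at hmul
  omega

/-- A maximum colouring is an entirely blue Turán graph. -/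
theorem IsMaxColoring.exists_equiv (hm : IsMaxColoring k R B) (hk : 6 ≤ k)
    (hV : k ≤ Fintype.card V) :
    R = ⊥ ∧ ∃ f : V ≃ Fin (Fintype.card V), ∀ a b, B.Adj a b ↔ (f a : ℕ) % k ≠ f b % k := by
  have hR := hm.red_eq_bot hk hV
  subst hR
  refine ⟨rfl, ?_⟩
  obtain ⟨P, hP⟩ := hm.exists_finpartition
  simp only [bot_sup_eq] at hP
  have hparts := hm.card_parts (P := P) (by simpa using hP) hV
  obtain ⟨f, hf⟩ := (hm.isEquipartition (by omega) hV hP).exists_partPreservingEquiv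
  refine ⟨(Equiv.subtypeUnivEquiv mem_univ).symm.trans f, fun a b => ?_⟩
  have := hf ⟨a, mem_univ a⟩ ⟨b, mem_univ b⟩
  rw [hparts] at this
  rw [hP, ne_eq, this]
  rfl

end MaximumColorings

/-! ### From triple systems to coloured graphs, by Hall's theorem. -/

section RedBlueDecomposition

open Finset

theorem exists_injOn_of_hall {α β : Type*} [DecidableEq α] [DecidableEq β] [Inhabited β]
    (X : Finset α) (t : α → Finset β) (h : ∀ S ⊆ X, #S ≤ #(S.biUnion t)) :
    ∃ f : α → β, Set.InjOn f X ∧ ∀ x ∈ X, f x ∈ t x := by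
  have key := (Finset.all_card_le_biUnion_card_iff_exists_injective
    (fun x : {x // x ∈ X} => t x)).1 (by
      intro s
      have := h (s.map (Function.Embedding.subtype _)) (by
        intro x hx
        rw [mem_map] at hx
        obtain ⟨y, -, rfl⟩ := hx
        exact y.2)
      rw [card_map] at this
      refine this.trans (card_le_card ?_)
      intro y hy
      simp only [mem_biUnion, mem_map] at hy ⊢
      obtain ⟨x, ⟨z, hz, rfl⟩, hy⟩ := hy
      exact ⟨z, hz, hy⟩)
  obtain ⟨f, hf, hft⟩ := key
  refine ⟨fun x => if hx : x ∈ X then f ⟨x, hx⟩ else default, ?_, ?_⟩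
  · intro x hx y hy hxy
    rw [mem_coe] at hx hy
    simp only [hx, hy, dif_pos] at hxy
    exact congrArg Subtype.val (hf hxy)
  · intro x hx
    simp only [hx, dif_pos]
    exact hft ⟨x, hx⟩

variable {V : Type*} [Fintype V] [DecidableEq V]

/-- A triple system has a subsystem `A'` whose shadow can be matched into `A'`, while the other
triples can be matched to pairs outside that shadow. -/
theorem exists_subsystem_matchings (A : Finset (Finset V)) :
    ∃ A' ⊆ A, ∃ f g : Finset V → Finset V,
      (Set.InjOn f (A \ A' : Finset _) ∧ ∀ h ∈ A \ A', f h ∈ h.powersetCard 2 ∧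
        f h ∉ A'.biUnion (powersetCard 2)) ∧
      (Set.InjOn g (A'.biUnion (powersetCard 2) : Finset _) ∧
        ∀ p ∈ A'.biUnion (powersetCard 2), g p ∈ A' ∧ p ⊆ g p) := by
  obtain ⟨A', hA', hmax⟩ := exists_max_image A.powerset
    (fun S => (#S : ℤ) - #(S.biUnion (powersetCard 2))) ⟨∅, by simp⟩
  rw [mem_powerset] at hA'
  set D := A'.biUnion (powersetCard 2) with hD
  -- A set `S` violating Hall's condition brings fewer new pairs than triples, so adding it to `A'`
  -- would raise the maximized difference.
  obtain ⟨f, hf, hft⟩ := exists_injOn_of_hall (A \ A') (fun h => h.powersetCard 2 \ D) (by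
    intro S hS
    have hdisj : Disjoint A' S := by
      rw [disjoint_left]
      exact fun x hx hx' => (mem_sdiff.1 (hS hx')).2 hx
    have h1 := hmax (A' ∪ S) (mem_powerset.2 (union_subset hA' (hS.trans sdiff_subset)))
    have h2 : (A' ∪ S).biUnion (powersetCard 2) = D ∪ S.biUnion (fun h => h.powersetCard 2 \ D) := by
      ext p
      have hp : p ∈ D ↔ ∃ h ∈ A', p ∈ h.powersetCard 2 := by rw [hD, mem_biUnion]
      by_cases hpD : p ∈ D
      · have := hp.1 hpD
        simp only [mem_biUnion, mem_union, hpD, true_or, iff_true]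
        exact this.imp fun h hh => ⟨Or.inl hh.1, hh.2⟩
      · have h' : ∀ h ∈ A', p ∉ h.powersetCard 2 := fun h hh hph => hpD (hp.2 ⟨h, hh, hph⟩)
        simp only [mem_biUnion, mem_union, mem_sdiff, hpD, false_or, not_false_eq_true, and_true]
        exact exists_congr fun h => ⟨fun hh => ⟨hh.1.resolve_left fun hA => h' h hA hh.2, hh.2⟩,
          fun hh => ⟨Or.inr hh.1, hh.2⟩⟩
    have h3 := card_union_le D (S.biUnion (fun h => h.powersetCard 2 \ D))
    rw [h2, card_union_of_disjoint hdisj] at h1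
    push_cast at h1
    omega)
  -- Deleting all triples `Q` that contain a pair of `S` uncovers all of `S`; if `#Q < #S`, the
  -- difference would rise.
  obtain ⟨g, hg, hgt⟩ := exists_injOn_of_hall D (fun p => {h ∈ A' | p ⊆ h}) (by
    intro S hS
    set Q := S.biUnion (fun p => {h ∈ A' | p ⊆ h}) with hQ
    have hQA : Q ⊆ A' := biUnion_subset.2 fun p _ => filter_subset _ _
    have h1 := hmax (A' \ Q) (mem_powerset.2 (sdiff_subset.trans hA'))
    have h2 : (A' \ Q).biUnion (powersetCard 2) ⊆ D \ S := by
      intro p hp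
      rw [mem_biUnion] at hp
      obtain ⟨h, hh, hp⟩ := hp
      rw [mem_sdiff] at hh
      rw [mem_sdiff, hD, mem_biUnion]
      refine ⟨⟨h, hh.1, hp⟩, fun hpS => hh.2 ?_⟩
      rw [hQ, mem_biUnion]
      exact ⟨p, hpS, mem_filter.2 ⟨hh.1, (mem_powersetCard.1 hp).1⟩⟩
    have h3 := card_le_card h2
    rw [card_sdiff_of_subset hS] at h3
    rw [card_sdiff_of_subset hQA] at h1
    have h4 := card_le_card hS
    have h5 := card_le_card hQA
    omega)
  refine ⟨A', hA', f, g, ⟨hf, fun h hh => mem_sdiff.1 (hft h hh)⟩, hg, fun p hp => ?_⟩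
  simpa using hgt p hp

/-- The size of a triple system is at most the number of red edges and blue triangles of a
red-blue coloured graph whose edges can be matched to triples containing them. -/
theorem exists_coloring_of_tripleSystem (A : Finset (Finset V)) (hA : ∀ h ∈ A, #h = 3) :
    ∃ R B : SimpleGraph V, (∀ x y, R.Adj x y → ¬ B.Adj x y) ∧ #A ≤ #(cells R B) ∧
      (R = ⊥ → A ⊆ cells ⊥ B) ∧
      ∃ φ : Finset V → Finset V, (∀ x y, (R ⊔ B).Adj x y → φ {x, y} ∈ A ∧ {x, y} ⊆ φ {x, y}) ∧
        ∀ x y z w, (R ⊔ B).Adj x y → (R ⊔ B).Adj z w → φ {x, y} = φ {z, w} →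
          ({x, y} : Finset V) = {z, w} := by
  classical
  obtain ⟨A', hA', f, g, ⟨hf, hf'⟩, hg, hg'⟩ := exists_subsystem_matchings A
  set D := A'.biUnion (powersetCard 2) with hD
  let R : SimpleGraph V :=
    { Adj := fun x y => x ≠ y ∧ ∃ h ∈ A \ A', f h = {x, y}
      symm := ⟨fun x y h => ⟨h.1.symm, by rw [pair_comm]; exact h.2⟩⟩
      loopless := ⟨fun x h => h.1 rfl⟩ }
  let B : SimpleGraph V :=
    { Adj := fun x y => x ≠ y ∧ {x, y} ∈ D
      symm := ⟨fun x y h => ⟨h.1.symm, by rw [pair_comm]; exact h.2⟩⟩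
      loopless := ⟨fun x h => h.1 rfl⟩ }
  have hR : ∀ h ∈ A \ A', R.IsNClique 2 (f h) := by
    intro h hh
    obtain ⟨x, y, hxy, he⟩ := card_eq_two.1 (mem_powersetCard.1 (hf' h hh).1).2
    rw [he]
    exact isNClique_two_pair.2 ⟨hxy, h, hh, he⟩
  have hB : ∀ h ∈ A', B.IsNClique 3 h := by
    intro h hh
    refine ⟨fun x hx y hy hxy => ⟨hxy, ?_⟩, hA h (hA' hh)⟩
    rw [hD, mem_biUnion]
    refine ⟨h, hh, mem_powersetCard.2 ⟨?_, card_pair hxy⟩⟩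
    rw [insert_subset_iff, singleton_subset_iff]
    exact ⟨hx, hy⟩
  refine ⟨R, B, ?_, ?_, ?_, ?_⟩
  · rintro x y ⟨-, h, hh, he⟩ ⟨-, hxy⟩
    exact (hf' h hh).2 (he ▸ hxy)
  -- Triples of `A'` are blue triangles and stay; the others go to their red edges. Sizes 3 and 2
  -- keep the two kinds apart.
  · apply card_le_card_of_injOn (fun h => if h ∈ A' then h else f h)
    · intro h hh
      rw [mem_coe, mem_cells]
      dsimp only
      split_ifs with hA1
      · exact Or.inr (hB h hA1)
      · exact Or.inl (hR h (mem_sdiff.2 ⟨hh, hA1⟩))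
    · have hc : ∀ h ∈ A, h ∉ A' → #(f h) = 2 := fun h hh h' =>
        (mem_powersetCard.1 (hf' h (mem_sdiff.2 ⟨hh, h'⟩)).1).2
      intro h hh h' hh' he
      rw [mem_coe] at hh hh'
      dsimp only at he
      split_ifs at he with h1 h2 h2
      · exact he
      · have := hc h' hh' h2
        rw [← he, hA h hh] at this
        omega
      · have := hc h hh h1
        rw [he, hA h' hh'] at this
        omega
      · exact hf (mem_coe.2 (mem_sdiff.2 ⟨hh, h1⟩)) (mem_coe.2 (mem_sdiff.2 ⟨hh', h2⟩)) he
  · intro hbot h hh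
    rw [mem_cells]
    right
    by_contra hno
    have h1 := hR h (mem_sdiff.2 ⟨hh, fun h' => hno (hB h h')⟩)
    rw [hbot] at h1
    obtain ⟨x, y, hxy, -⟩ := exists_adj_eq_pair h1
    exact hxy
  -- `φ` is `g` on blue pairs and inverts `f` on red ones; `∅` is a dummy value elsewhere. The two
  -- kinds of values cannot collide, lying in `A'` and in `A \ A'`.
  · have hex : ∀ p : Finset V, ∃ h, (p ∉ D → (∃ h ∈ A \ A', f h = p) → h ∈ A \ A' ∧ f h = p) ∧
        (p ∈ D → h = g p) := by
      intro p
      by_cases hp : p ∈ D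
      · exact ⟨g p, fun h => absurd hp h, fun _ => rfl⟩
      · by_cases h : ∃ h ∈ A \ A', f h = p
        · obtain ⟨h, hh⟩ := h
          exact ⟨h, fun _ _ => hh, fun h' => absurd h' hp⟩
        · exact ⟨∅, fun _ h' => absurd h' h, fun h' => absurd h' hp⟩
    choose φ hφ1 hφ2 using hex
    have hcases : ∀ x y, (R ⊔ B).Adj x y → ({x, y} ∈ D ∧ φ {x, y} = g {x, y}) ∨
        ({x, y} ∉ D ∧ φ {x, y} ∈ A \ A' ∧ f (φ {x, y}) = {x, y}) := by
      intro x y hxy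
      by_cases hp : {x, y} ∈ D
      · exact Or.inl ⟨hp, hφ2 _ hp⟩
      · refine Or.inr ⟨hp, hφ1 _ hp ?_⟩
        rcases hxy with h | h
        · exact h.2
        · exact absurd h.2 hp
    refine ⟨φ, ?_, ?_⟩
    · intro x y hxy
      rcases hcases x y hxy with ⟨hp, he⟩ | ⟨-, hm, he⟩
      · rw [he]
        exact ⟨hA' (hg' _ hp).1, (hg' _ hp).2⟩
      · refine ⟨(mem_sdiff.1 hm).1, ?_⟩
        have := (mem_powersetCard.1 (hf' _ hm).1).1
        rwa [he] at this
    · intro x y z w hxy hzw h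
      rcases hcases x y hxy with ⟨hp, he⟩ | ⟨-, hm, he⟩ <;>
        rcases hcases z w hzw with ⟨hp', he'⟩ | ⟨-, hm', he'⟩
      · exact hg hp hp' (by rw [← he, ← he', h])
      · rw [← h, he] at hm'
        exact absurd (hg' _ hp).1 (mem_sdiff.1 hm').2
      · rw [h, he'] at hm
        exact absurd (hg' _ hp').1 (mem_sdiff.1 hm).2
      · rw [← he, ← he', h]

end RedBlueDecomposition

/-! ### Back to hypergraphs: Berge copies, the Turán hypergraph, the extremal bound. -/

section Hypergraphs

universe u

/-- A hypergraph with a complete Berge-hypergraph on the core `c` is not free. -/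
theorem exists_mem_bergeFamily_contains {α : Type u} {r n : ℕ} {H : Hypergraph α}
    (hH : IsRGraph r H) (hn : 0 < n) (c : Fin n → α)
    (e : {p : Fin n × Fin n // p.1 < p.2} → Set α) (hc : Function.Injective c)
    (hcH : ∀ i, c i ∈ H.vertexSet) (he : Function.Injective e) (heH : ∀ p, e p ∈ H.edgeSet)
    (hce : ∀ p, c p.1.1 ∈ e p ∧ c p.1.2 ∈ e p) :
    ∃ F ∈ bergeFamily r n, Contains H F := by
  obtain ⟨g, hg⟩ := Set.countable_iff_exists_injOn.1 hH.finite.countable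
  have hsub : ∀ p, e p ⊆ H.vertexSet := fun p => H.subset_vertexSet_of_mem_edgeSet' (heH p)
  have hW : Set.range c ∪ ⋃ p, e p ⊆ H.vertexSet := by
    rintro x (⟨i, rfl⟩ | hx)
    · exact hcH i
    · obtain ⟨p, hp⟩ := Set.mem_iUnion.1 hx
      exact hsub p hp
  -- The forbidden family lives on `ℕ`, so the Berge-hypergraph is transported along an injection
  -- `g` of the vertex set.
  let F : Hypergraph ℕ :=
    { vertexSet := g '' (Set.range c ∪ ⋃ p, e p)
      edgeSet := Set.range fun p => g '' e p
      subset_vertexSet_of_mem_edgeSet' := by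
        rintro _ ⟨p, rfl⟩
        exact Set.image_mono ((Set.subset_iUnion e p).trans Set.subset_union_right) }
  refine ⟨F, ⟨⟨(hH.finite.subset hW).image g, ⟨g (c ⟨0, hn⟩), c ⟨0, hn⟩, Or.inl ⟨_, rfl⟩, rfl⟩, ?_⟩,
    fun i => g (c i), fun p => g '' e p, ?_, ?_, ?_, rfl, ?_⟩, ?_⟩
  · rintro _ ⟨p, rfl⟩
    dsimp only
    rw [Set.InjOn.ncard_image (hg.mono (hsub p))]
    exact hH.uniform _ (heH p)
  · exact fun i j hij => hc (hg (hcH i) (hcH j) hij)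
  · intro p q hpq
    exact he ((hg.image_eq_image_iff (hsub p) (hsub q)).1 hpq)
  · exact fun p => ⟨⟨_, (hce p).1, rfl⟩, ⟨_, (hce p).2, rfl⟩⟩
  · simp only [F, Set.image_union, Set.image_iUnion, ← Set.range_comp]
    rfl
  · have : Nonempty α := ⟨c ⟨0, hn⟩⟩
    have hinv : Set.LeftInvOn (Function.invFunOn g H.vertexSet) g H.vertexSet := hg.leftInvOn_invFunOn
    refine ⟨Function.invFunOn g H.vertexSet, ?_, ?_, ?_⟩
    · rintro _ ⟨x, hx, rfl⟩ _ ⟨y, hy, rfl⟩ hxy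
      rw [hinv (hW hx), hinv (hW hy)] at hxy
      rw [hxy]
    · rintro _ ⟨x, hx, rfl⟩
      rw [hinv (hW hx)]
      exact hW hx
    · rintro _ ⟨p, rfl⟩
      dsimp only
      rw [(hinv.mono (hsub p)).image_image]
      exact heH p

/-- Two of the `n` core vertices fall into the same of the `n - 1` parts, yet they would share an
edge. -/
theorem isFreeRGraph_turanHypergraph {r N n : ℕ} (hN : 0 < N) (hn : 2 ≤ n) :
    IsFreeRGraph r N (bergeFamily r n) (turanHypergraph r N (n - 1)) := by
  refine ⟨⟨Set.finite_Iio N, ⟨0, hN⟩, fun e he => he.2.1⟩, ?_, ?_⟩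
  · change (Set.Iio N).ncard = N
    rw [← Finset.coe_Iio, Set.ncard_coe_finset, Nat.card_Iio]
  · rintro F ⟨-, c, e, hc, -, hce, hE, hV⟩ ⟨f, hf, -, hfe⟩
    obtain ⟨i, -, j, -, hij, h⟩ := Finset.exists_ne_map_eq_of_card_lt_of_maps_to
      (s := (Finset.univ : Finset (Fin n))) (t := Finset.range (n - 1))
      (f := fun i => f (c i) % (n - 1)) (by simp; omega)
      (fun i _ => by
        simp only [Finset.coe_range, Set.mem_Iio]
        exact Nat.mod_lt _ (by omega))
    wlog hlt : i < j generalizing i j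
    · exact this j i hij.symm h.symm (lt_of_le_of_ne (le_of_not_gt hlt) hij.symm)
    have hmem := hfe (e ⟨(i, j), hlt⟩) (hE ▸ ⟨_, rfl⟩)
    have hci : ∀ i, c i ∈ F.vertexSet := fun i => hV ▸ Or.inl ⟨i, rfl⟩
    have := hmem.2.2 ⟨_, (hce ⟨(i, j), hlt⟩).1, rfl⟩ ⟨_, (hce ⟨(i, j), hlt⟩).2, rfl⟩ h
    exact hij (hc (hf (hci i) (hci j) this))

theorem isNClique_three_iff_image_mem_turanHypergraph {V : Type*} {N k : ℕ} {B : SimpleGraph V}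
    (f : V ≃ Fin N) (hf : ∀ a b, B.Adj a b ↔ (f a : ℕ) % k ≠ f b % k) (s : Finset V) :
    B.IsNClique 3 s ↔ (fun v => (f v : ℕ)) '' s ∈ (turanHypergraph 3 N k).edgeSet := by
  have hinj : Function.Injective fun v => (f v : ℕ) := Fin.val_injective.comp f.injective
  have hsub : (fun v => (f v : ℕ)) '' s ⊆ Set.Iio N := by
    rintro _ ⟨v, -, rfl⟩
    exact (f v).2
  have hcard : ((fun v => (f v : ℕ)) '' s).ncard = s.card := by
    rw [Set.ncard_image_of_injective _ hinj, Set.ncard_coe_finset]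
  change _ ↔ (_ ⊆ Set.Iio N ∧ _ = 3 ∧ Set.InjOn _ _)
  rw [hcard, SimpleGraph.isNClique_iff, and_comm]
  refine ⟨fun h => ⟨hsub, h.1, ?_⟩, fun h => ⟨h.2.1, ?_⟩⟩
  · rintro _ ⟨a, ha, rfl⟩ _ ⟨b, hb, rfl⟩ hab
    by_contra hne
    exact (hf a b).1 (h.2 ha hb fun e => hne (by rw [e])) hab
  · intro a ha b hb hab
    rw [hf]
    exact fun e => hab (hinj (h.2.2 ⟨a, ha, rfl⟩ ⟨b, hb, rfl⟩ e))

theorem card_cells_eq_turanEdges {V : Type*} [Fintype V] [DecidableEq V] {N k : ℕ}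
    {B : SimpleGraph V} (f : V ≃ Fin N) (hf : ∀ a b, B.Adj a b ↔ (f a : ℕ) % k ≠ f b % k) :
    (cells ⊥ B).card = turanEdges 3 N k := by
  classical
  have hinj : Function.Injective fun v => (f v : ℕ) := Fin.val_injective.comp f.injective
  have hmem : ∀ s, s ∈ cells ⊥ B ↔ B.IsNClique 3 s := by
    intro s
    rw [mem_cells]
    refine ⟨fun h => h.resolve_left fun h' => ?_, Or.inr⟩
    obtain ⟨x, y, hxy, -⟩ := exists_adj_eq_pair h'
    exact hxy
  have himg : (turanHypergraph 3 N k).edgeSet =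
      (fun s : Finset V => (fun v => (f v : ℕ)) '' (s : Set V)) '' (cells ⊥ B : Set (Finset V)) := by
    ext e
    simp only [Set.mem_image, Finset.mem_coe, hmem,
      isNClique_three_iff_image_mem_turanHypergraph f hf]
    constructor
    · intro he
      have hs : (fun v => (f v : ℕ)) '' ((Finset.univ.filter fun v => (f v : ℕ) ∈ e : Finset V) :
          Set V) = e := by
        ext x
        simp only [Finset.coe_filter, Finset.mem_univ, true_and, Set.mem_image, Set.mem_ofPred_eq]
        constructor
        · rintro ⟨v, hv, rfl⟩
          exact hv
        · intro hx
          exact ⟨f.symm ⟨x, he.1 hx⟩, by simpa using hx, by simp⟩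
      exact ⟨_, by rwa [hs], hs⟩
    · rintro ⟨s, hs, rfl⟩
      exact hs
  rw [turanEdges, numEdges, himg, Set.ncard_image_of_injective, Set.ncard_coe_finset]
  intro s t hst
  exact Finset.coe_injective (hinj.image_injective hst)

open Finset in
/-- The upper bound for the number of edges, with the equality case. -/
theorem IsFreeRGraph.numEdges_le {α : Type u} {N n : ℕ} (hn : 7 ≤ n) (hN : n ≤ N)
    {H : Hypergraph α} (hH : IsFreeRGraph 3 N (bergeFamily 3 n) H) :
    numEdges H ≤ turanEdges 3 N (n - 1) ∧ (numEdges H = turanEdges 3 N (n - 1) →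
      IsIsomorphic H (turanHypergraph 3 N (n - 1))) := by
  classical
  obtain ⟨hr, horder, hfree⟩ := hH
  have : Fintype H.vertexSet := hr.finite.fintype
  have hcard : Fintype.card H.vertexSet = N := by
    rw [← horder, order, Set.ncard_eq_toFinset_card', Set.toFinset_card]
  have hval : Function.Injective (Subtype.val : H.vertexSet → α) := Subtype.val_injective
  set A : Finset (Finset H.vertexSet) :=
    univ.filter fun s => Subtype.val '' (s : Set H.vertexSet) ∈ H.edgeSet with hA
  have hAm : ∀ s, s ∈ A ↔ Subtype.val '' (s : Set H.vertexSet) ∈ H.edgeSet := by simp [hA]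
  have hA3 : ∀ s ∈ A, #s = 3 := by
    intro s hs
    have := hr.uniform _ ((hAm s).1 hs)
    rwa [Set.ncard_image_of_injective _ hval, Set.ncard_coe_finset] at this
  have hsurj : ∀ e ⊆ H.vertexSet, ∃ s : Finset H.vertexSet, Subtype.val '' (s : Set H.vertexSet) = e := by
    intro e he
    refine ⟨univ.filter fun v => (v : α) ∈ e, ?_⟩
    ext x
    simp only [coe_filter, mem_univ, true_and, Set.mem_image, Set.mem_ofPred_eq]
    constructor
    · rintro ⟨v, hv, rfl⟩
      exact hv
    · exact fun hx => ⟨⟨x, he hx⟩, hx, rfl⟩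
  have hnum : numEdges H = #A := by
    have : H.edgeSet =
        (fun s : Finset H.vertexSet => Subtype.val '' (s : Set H.vertexSet)) '' (A : Set _) := by
      ext e
      simp only [Set.mem_image, mem_coe, hAm]
      constructor
      · intro he
        obtain ⟨s, rfl⟩ := hsurj e (H.subset_vertexSet_of_mem_edgeSet' he)
        exact ⟨s, he, rfl⟩
      · rintro ⟨s, hs, rfl⟩
        exact hs
    rw [numEdges, this, Set.ncard_image_of_injective, Set.ncard_coe_finset]
    intro s t hst
    exact coe_injective (hval.image_injective hst)
  obtain ⟨R, B, hdisj, hle, hsub, φ, hφ, hφinj⟩ := exists_coloring_of_tripleSystem A hA3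
  have hcol : IsColoring (n - 1) R B := by
    refine ⟨hdisj, ?_⟩
    rw [Nat.sub_add_cancel (by omega)]
    intro z hz
    let c : Fin n ≃ z := (z.equivFinOfCardEq hz.card_eq).symm
    have hcadj : ∀ i j, i ≠ j → (R ⊔ B).Adj (c i : H.vertexSet) (c j) := fun i j hij =>
      hz.isClique (c i).2 (c j).2 fun h => hij (c.injective (Subtype.ext h))
    obtain ⟨F, hF, hHF⟩ := exists_mem_bergeFamily_contains hr (by omega)
      (fun i : Fin n => ((c i : H.vertexSet) : α))
      (fun p => Subtype.val ''
        (φ {(c p.1.1 : H.vertexSet), (c p.1.2 : H.vertexSet)} : Set H.vertexSet))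
      (fun i j h => c.injective (Subtype.ext (Subtype.ext h)))
      (fun i => (c i : H.vertexSet).2)
      (by
        rintro ⟨⟨i, j⟩, hij⟩ ⟨⟨i', j'⟩, hij'⟩ h
        have h1 := hφinj _ _ _ _ (hcadj i j hij.ne) (hcadj i' j' hij'.ne)
          (coe_injective (hval.image_injective h))
        have hinj : Function.Injective fun i => (c i : H.vertexSet) :=
          fun i j h => c.injective (Subtype.ext h)
        have h2 : (c i : H.vertexSet) ∈ ({(c i' : H.vertexSet), (c j' : H.vertexSet)} : Finset _) :=
          h1 ▸ mem_insert_self _ _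
        have h3 : (c j : H.vertexSet) ∈ ({(c i' : H.vertexSet), (c j' : H.vertexSet)} : Finset _) :=
          h1 ▸ by simp
        rw [mem_insert, mem_singleton] at h2 h3
        dsimp only at hij hij'
        simp only [Subtype.mk.injEq, Prod.mk.injEq]
        rcases h2 with h2 | h2 <;> rcases h3 with h3 | h3 <;>
          have h2 := hinj h2 <;> have h3 := hinj h3 <;> omega)
      (fun p => (hAm _).1 (hφ _ _ (hcadj _ _ p.2.ne)).1)
      (fun p => by
        have := (hφ _ _ (hcadj _ _ p.2.ne)).2
        exact ⟨⟨c p.1.1, this (by simp), rfl⟩, ⟨c p.1.2, this (by simp), rfl⟩⟩)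
    exact hfree F hF hHF
  -- An arbitrary maximum colouring serves to evaluate the maximum as `turanEdges`.
  obtain ⟨R₀, B₀, hm₀⟩ := exists_isMaxColoring (V := H.vertexSet) (k := n - 1) (by omega)
  obtain ⟨rfl, f₀, hf₀⟩ := hm₀.exists_equiv (by omega) (by omega)
  have hmax := card_cells_eq_turanEdges f₀ hf₀
  rw [hcard] at hmax
  have hle' := hm₀.max R B hcol
  refine ⟨by omega, fun heq => ?_⟩
  obtain ⟨rfl, f, hf⟩ := (hm₀.of_card_le hcol (by omega)).exists_equiv (by omega) (by omega)
  -- Under equality the colouring is itself maximum, hence without red edges; then the triples are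
  -- all blue triangles, and by count they exhaust them.
  have hAeq : A = cells ⊥ B := eq_of_subset_of_card_le (hsub rfl) (by omega)
  have hiff : ∀ s, s ∈ A ↔ B.IsNClique 3 s := by
    intro s
    rw [hAeq, mem_cells]
    refine ⟨fun h => h.resolve_left fun h' => ?_, Or.inr⟩
    obtain ⟨x, y, hxy, -⟩ := exists_adj_eq_pair h'
    exact hxy
  set g : α → ℕ := fun x => if hx : x ∈ H.vertexSet then f ⟨x, hx⟩ else 0 with hg
  have hgv : ∀ v : H.vertexSet, g v = f v := fun v => by simp [hg]
  have hVt : (turanHypergraph 3 N (n - 1)).vertexSet = Set.Iio N := rfl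
  refine ⟨g, ⟨?_, ?_, ?_⟩, ?_⟩
  · intro x hx
    rw [hgv ⟨x, hx⟩, hVt, Set.mem_Iio]
    have := (f ⟨x, hx⟩).2
    omega
  · intro x hx y hy hxy
    rw [hgv ⟨x, hx⟩, hgv ⟨y, hy⟩] at hxy
    exact congrArg Subtype.val (f.injective (Fin.ext hxy))
  · intro m hm
    rw [hVt, Set.mem_Iio] at hm
    refine ⟨f.symm ⟨m, by omega⟩, (f.symm ⟨m, by omega⟩).2, ?_⟩
    rw [hgv]
    simp
  · intro e he
    obtain ⟨s, rfl⟩ := hsurj e he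
    have hN' : turanHypergraph 3 (Fintype.card H.vertexSet) (n - 1) =
        turanHypergraph 3 N (n - 1) := by rw [hcard]
    rw [← hAm, hiff, isNClique_three_iff_image_mem_turanHypergraph f hf, hN', Set.image_image]
    simp only [hgv]

end Hypergraphs

end BergeTuran

theorem theorem1 (N n : ℕ) (hn : 13 ≤ n) (hN : n ≤ N) :
    BergeTuran.turanNumber 3 N (BergeTuran.bergeFamily 3 n) = BergeTuran.turanEdges 3 N (n - 1) ∧
    BergeTuran.IsExtremal 3 N (BergeTuran.bergeFamily 3 n)
      (BergeTuran.turanHypergraph 3 N (n - 1)) ∧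
    ∀ (α : Type*) (H : Hypergraph α),
      BergeTuran.IsExtremal 3 N (BergeTuran.bergeFamily 3 n) H →
        BergeTuran.IsIsomorphic H (BergeTuran.turanHypergraph 3 N (n - 1)) := by
  have hfree := BergeTuran.isFreeRGraph_turanHypergraph (r := 3) (N := N) (n := n)
    (by omega) (by omega)
  have hex : BergeTuran.turanNumber 3 N (BergeTuran.bergeFamily 3 n) =
      BergeTuran.turanEdges 3 N (n - 1) := by
    refine IsGreatest.csSup_eq ⟨⟨_, hfree, rfl⟩, ?_⟩
    rintro m ⟨H, hH, rfl⟩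
    exact (hH.numEdges_le (by omega) hN).1
  exact ⟨hex, ⟨hfree, hex.symm⟩, fun α H hH =>
    (hH.1.numEdges_le (by omega) hN).2 (hH.2.trans hex)⟩
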